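/- Let $n\ge 1$, $0\le\alpha<n$ and $1<p\le q<\infty$. A cube is a set $Q\subset\mathbb R^n$ with sides parallel to the coordinate axes and side length in $(0,\infty)$. A weight is a non-negative measurable function $w:\mathbb R^n\to[0,\infty)$ that is positive on a set of positive Lebesgue measure, and $w(E)=\int_E w\,dx$. For measurable $f$ let \[ M_\alpha f(x)=\sup_{Q}\,|Q|^{\alpha/n}\Big(\frac1{|Q|}\int_Q|f(y)|\,dy\Big)\chi_Q(x)\in[0,\infty], \] the supremum being over all cubes $Q$. For weights $u,\sigma$ put \[ \mathcal M_\alpha=\sup_Q\ \sigma(Q)^{-1/p}\Big(\int_Q M_\alpha(\chi_Q\sigma)(x)^q\,u(x)\,dx\Big)^{1/q}, \] where cubes with $\sigma(Q)=0$ contribute $0$. Then there is a finite constant $C=C(n,p,\alpha)$, independent of $q$, $u$ and $\sigma$, such that for every pair of weights $(u,\sigma)$ the following are equivalent: (1) $(u,\sigma)$ satisfies the testing condition: $\sigma(Q)<\infty$ for every cube $Q$ (so that $\mathcal M_\alpha$ is well defined) and $\mathcal M_\alpha<\infty$; (2) $M_\alpha(\cdot\,\sigma)$ is bounded from $L^p(\sigma)$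 to $L^q(u)$: there is $A<\infty$ such that for every $f\in L^p(\sigma)$ \[ \Big(\int_{\mathbb R^n}M_\alpha(f\sigma)(x)^q\,u(x)\,dx\Big)^{1/q}\le A\Big(\int_{\mathbb R^n}|f(x)|^p\sigma(x)\,dx\Big)^{1/p}. \] Moreover, when these hold, the inequality in (2) holds with $A=C\,\mathcal M_\alpha$. -/

import Mathlib

open MeasureTheory Set
open scoped ENNReal NNReal

/-- A (non-degenerate) cube `∏ᵢ [aᵢ, aᵢ + ℓ)` in `ℝⁿ` with sides parallel to the coordinate axes. -/
structure Cube (n : ℕ) where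
  corner : Fin n → ℝ
  side : ℝ
  side_pos : 0 < side

/-- The set of points of a cube. The faces are null sets, and including or excluding them changes
neither the maximal operator nor the testing quantity below. -/
def Cube.set {n : ℕ} (Q : Cube n) : Set (Fin n → ℝ) :=
  Set.univ.pi fun i => Set.Ico (Q.corner i) (Q.corner i + Q.side)

/-- A weight: a non-negative measurable function that is positive on a set of positive measure. -/
structure IsWeight {n : ℕ} (w : (Fin n → ℝ) → ℝ) : Prop where
  aemeasurable : AEMeasurable w volume
  nonneg : ∀ x, 0 ≤ w x
  pos : 0 < volume {x | 0 < w x}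

/-- The measure `w dx`. -/
noncomputable def weightMeasure {n : ℕ} (w : (Fin n → ℝ) → ℝ) : Measure (Fin n → ℝ) :=
  volume.withDensity fun x => ENNReal.ofReal (w x)

/-- The fractional maximal operator
`M_α f(x) = sup_Q |Q|^{α/n} (⨍_Q |f(y)| dy) χ_Q(x)`, with values in `[0, ∞]`. -/
noncomputable def fracMax {n : ℕ} (α : ℝ) (f : (Fin n → ℝ) → ℝ) (x : Fin n → ℝ) : ℝ≥0∞ :=
  ⨆ Q : Cube n,
    Q.set.indicator
      (fun _ => volume Q.set ^ (α / (n : ℝ)) * ⨍⁻ y in Q.set, ‖f y‖ₑ ∂volume) x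

/-- The testing quantity
`sup_Q σ(Q)^{-1/p} (∫_Q M_α(χ_Q σ)(x)^q u(x) dx)^{1/q}`.
A cube with `σ(Q) = 0` contributes `0`, since then `M_α(χ_Q σ) = 0`. -/
noncomputable def testingConst {n : ℕ} (α p q : ℝ) (u σ : (Fin n → ℝ) → ℝ) : ℝ≥0∞ :=
  ⨆ Q : Cube n,
    weightMeasure σ Q.set ^ (-1 / p) *
      (∫⁻ x in Q.set, fracMax α (Q.set.indicator σ) x ^ q ∂(weightMeasure u)) ^ (1 / q)

/-- The testing condition: the testing quantity makes sense, that is `σ(Q) < ∞` for every cube `Q`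
(so that no quotient is of the form `∞ / ∞`), and it is finite. -/
def TestingCondition {n : ℕ} (α p q : ℝ) (u σ : (Fin n → ℝ) → ℝ) : Prop :=
  (∀ Q : Cube n, weightMeasure σ Q.set < ∞) ∧ testingConst α p q u σ < ∞

/-- The strong type inequality
`(∫ M_α(f σ)^q u dx)^{1/q} ≤ A (∫ |f|^p σ dx)^{1/p}` for every `f ∈ L^p(σ)`. -/
def StrongTypeBound {n : ℕ} (α p q : ℝ) (u σ : (Fin n → ℝ) → ℝ) (A : ℝ≥0∞) : Prop :=
  ∀ f : (Fin n → ℝ) → ℝ, MemLp f (ENNReal.ofReal p) (weightMeasure σ) →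
    (∫⁻ x, fracMax α (fun y => f y * σ y) x ^ q ∂(weightMeasure u)) ^ (1 / q) ≤
      A * (∫⁻ x, ‖f x‖ₑ ^ p ∂(weightMeasure σ)) ^ (1 / p)

/-! Sufficiency is proved dyadically, by a principal-cell argument. In a dyadic grid with a coarsest
mesh, let R run over the maximal cells on which the σ-average of |f| exceeds 2^k. A cell with
average in (2^k, 2^(k+1)] lies in such an R, so its term is at most 2^(k+1) times a term of the
maximal function of χ_R σ. The testing condition on R bounds the q-th power integral by (2K)^q ∑
(2^(kp) σ(R))^(q/p). As q/p ≥ 1, the power moves outside the sum, and ∑ 2^(kp) σ(R) ≲ ∫ |f|^p σ by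
disjointness of the R at each level and a layer-cake sum over k (`tsum_stopping_le`,
`lintegral_cellMax_le`).

By the one-third trick every cube of side at most L/3 lies in a comparable cell of one of 2^n
shifted grids with top mesh L (`Cube.exists_subset_grid`). Fatou's lemma along L = 2^N removes the
restriction on size.

For necessity, test on f = χ_Q. This requires σ(Q) < ∞, which itself follows from the strong bound:
for truncations of σ with mass t it reads a t ≤ A t^(1/p), and p > 1 bounds t uniformly
(`StrongTypeBound.weightMeasure_lt_top`). -/

/-! ### Power sums and the dyadic layer cake -/

theorem ENNReal.tsum_rpow_le_rpow_tsum {ι : Type*} (a : ι → ℝ≥0∞) {s : ℝ} (hs : 1 ≤ s) :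
    ∑' i, a i ^ s ≤ (∑' i, a i) ^ s := by
  have key : ∀ x : ℝ≥0∞, x ^ s = x * x ^ (s - 1) := fun x => by
    conv_lhs => rw [show s = 1 + (s - 1) by ring,
      ENNReal.rpow_add_of_nonneg _ _ zero_le_one (by linarith), ENNReal.rpow_one]
  rw [key (∑' i, a i), ← ENNReal.tsum_mul_right]
  refine ENNReal.tsum_le_tsum fun i => ?_
  rw [key]
  exact mul_le_mul_right (ENNReal.rpow_le_rpow (ENNReal.le_tsum i) (by linarith)) _

/-- The constant in the dyadic layer-cake estimate `tsum_layer_le`. -/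
noncomputable def layerConst (p : ℝ) : ℝ≥0∞ :=
  2 * 2 ^ (p - 1) * (1 - 2⁻¹ ^ (p - 1))⁻¹

theorem layerConst_ne_top {p : ℝ} (hp : 1 < p) : layerConst p ≠ ∞ := by
  unfold layerConst
  refine ENNReal.mul_ne_top (ENNReal.mul_ne_top (by simp) ?_) ?_
  · exact ENNReal.rpow_ne_top_of_nonneg (by linarith) (by simp)
  · rw [ENNReal.inv_ne_top]
    refine (tsub_pos_of_lt ?_).ne'
    exact ENNReal.rpow_lt_one (by simp) (by linarith)

theorem layerConst_ne_zero {p : ℝ} : layerConst p ≠ 0 := by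
  unfold layerConst
  refine mul_ne_zero (mul_ne_zero (by simp) ?_) ?_
  · simp [ENNReal.rpow_eq_zero_iff]
  · rw [Ne, ENNReal.inv_eq_zero]
    exact (tsub_le_self.trans_lt ENNReal.one_lt_top).ne

/-- Only the k with 2^k < 2t contribute; descending from the largest, the terms are dominated by a
geometric series of ratio 2^(1-p) < 1. -/
theorem tsum_layer_le {p : ℝ} (hp : 1 < p) (t : ℝ≥0∞) :
    ∑' k : ℤ, 2 * ((2 : ℝ≥0∞) ^ k) ^ (p - 1) * (if (2 : ℝ≥0∞) ^ k < 2 * t then t else 0) ≤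
      layerConst p * t ^ p := by
  rcases eq_or_ne t 0 with rfl | h0
  · simp
  rcases eq_or_ne t ∞ with rfl | htop
  · rw [ENNReal.top_rpow_of_pos (by linarith), ENNReal.mul_top layerConst_ne_zero]
    exact le_top
  have hp1 : 0 < p - 1 := by linarith
  obtain ⟨K, hK, hK'⟩ := ENNReal.exists_mem_Ico_zpow (x := 2 * t) (y := 2)
    (mul_ne_zero two_ne_zero h0) (ENNReal.mul_ne_top (by simp) htop) (by simp) (by simp)
  have hinj : Function.Injective (fun i : ℕ => K - (i : ℤ)) := fun a b h => by
    simpa using h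
  have hsupp : Function.support (fun k : ℤ => 2 * ((2 : ℝ≥0∞) ^ k) ^ (p - 1) *
      (if (2 : ℝ≥0∞) ^ k < 2 * t then t else 0)) ⊆ range (fun i : ℕ => K - (i : ℤ)) := by
    intro k hk
    have hlt : (2 : ℝ≥0∞) ^ k < 2 * t := by
      by_contra h
      simp [h] at hk
    have hkK : k < K + 1 := by
      by_contra h
      push Not at h
      exact absurd (hlt.trans hK') (not_lt.2 (ENNReal.zpow_le_of_le (by simp) h))
    exact ⟨(K - k).toNat, by simp only; omega⟩
  rw [← hinj.tsum_eq hsupp]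
  have hterm : ∀ i : ℕ, 2 * ((2 : ℝ≥0∞) ^ (K - (i : ℤ))) ^ (p - 1) *
      (if (2 : ℝ≥0∞) ^ (K - (i : ℤ)) < 2 * t then t else 0) ≤
      (2 * (2 * t) ^ (p - 1) * t) * ((2⁻¹ : ℝ≥0∞) ^ (p - 1)) ^ i := by
    intro i
    have h1 : ((2 : ℝ≥0∞) ^ (K - (i : ℤ))) ^ (p - 1) ≤
        (2 * t) ^ (p - 1) * ((2⁻¹ : ℝ≥0∞) ^ (p - 1)) ^ i := by
      rw [sub_eq_add_neg, ENNReal.zpow_add two_ne_zero (by simp),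
        ENNReal.mul_rpow_of_nonneg _ _ hp1.le, ENNReal.zpow_neg, zpow_natCast,
        ENNReal.inv_pow]
      rw [← ENNReal.rpow_natCast, ← ENNReal.rpow_natCast, ← ENNReal.rpow_mul, ← ENNReal.rpow_mul,
        mul_comm (i : ℝ)]
      gcongr
    calc _ ≤ 2 * ((2 * t) ^ (p - 1) * ((2⁻¹ : ℝ≥0∞) ^ (p - 1)) ^ i) * t := by
          gcongr
          split_ifs <;> simp
      _ = _ := by ring
  refine (ENNReal.tsum_le_tsum hterm).trans ?_
  rw [ENNReal.tsum_mul_left, ENNReal.tsum_geometric, layerConst,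
    ENNReal.mul_rpow_of_nonneg _ _ hp1.le]
  have : t ^ p = t ^ (p - 1) * t := by
    conv_lhs => rw [show p = (p - 1) + 1 by ring,
      ENNReal.rpow_add_of_nonneg _ _ hp1.le zero_le_one, ENNReal.rpow_one]
  rw [this]
  apply le_of_eq
  ring

/-- The part of s where 2g ≤ a carries at most half of a ν(s), so the part where g is large carries
the other half. -/
theorem mul_measure_le_of_lt_setLIntegral {X : Type*} [MeasurableSpace X] (ν : Measure X)
    {g : X → ℝ≥0∞} (hg : Measurable g) {s : Set X} (hs : ν s ≠ ∞) {a : ℝ≥0∞} (ha : a ≠ ∞)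
    (h : a * ν s < ∫⁻ y in s, g y ∂ν) :
    a * ν s ≤ 2 * ∫⁻ y in s, (if a < 2 * g y then g y else 0) ∂ν := by
  have hm : Measurable fun y => if a < 2 * g y then g y else 0 :=
    Measurable.ite (measurableSet_lt measurable_const (hg.const_mul 2)) hg measurable_const
  have hsplit : ∫⁻ y in s, g y ∂ν ≤
      ∫⁻ y in s, (if a < 2 * g y then g y else 0) ∂ν + a / 2 * ν s := by
    rw [← setLIntegral_const, ← lintegral_add_left hm]
    refine lintegral_mono fun y => ?_
    simp only
    split_ifs with hy
    · exact le_self_add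
    · rw [zero_add, ENNReal.le_div_iff_mul_le (by simp) (by simp), mul_comm]
      exact not_lt.1 hy
  set A := ∫⁻ y in s, (if a < 2 * g y then g y else 0) ∂ν
  have h2 : a * ν s = a / 2 * ν s + a / 2 * ν s := by
    rw [← add_mul, ENNReal.add_halves]
  have hfin : a / 2 * ν s ≠ ∞ := ENNReal.mul_ne_top (ENNReal.div_ne_top ha (by simp)) hs
  have h3 : a / 2 * ν s + a / 2 * ν s < A + a / 2 * ν s := h2 ▸ h.trans_le hsplit
  have h4 : a / 2 * ν s < A := (ENNReal.add_lt_add_iff_right hfin).1 h3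
  rw [h2, two_mul]
  exact add_le_add h4.le h4.le

/-! ### Stopping cells and the dyadic testing theorem -/

section Stopping

variable {X ι : Type*}

/-- A heavy cell of a nested sequence of partitions that lies in no coarser heavy cell. -/
def IsStopping (π : ℕ → X → ι) (H : ℕ → ι → Prop) (r : ℕ × ι) : Prop :=
  H r.1 r.2 ∧ ∀ x, π r.1 x = r.2 → ∀ i < r.1, ¬ H i (π i x)

theorem eq_of_nested {π : ℕ → X → ι}
    (nest : ∀ j x y, π (j + 1) x = π (j + 1) y → π j x = π j y) {i j : ℕ} (hij : i ≤ j)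
    {x y : X} (h : π j x = π j y) : π i x = π i y := by
  induction j, hij using Nat.le_induction with
  | base => exact h
  | succ j _ ih => exact ih (nest j x y h)

/-- Levels are natural numbers, so there is a coarsest heavy cell around x; this is why the grids
have a top mesh. -/
theorem exists_isStopping {π : ℕ → X → ι} {H : ℕ → ι → Prop}
    (nest : ∀ j x y, π (j + 1) x = π (j + 1) y → π j x = π j y) {x : X} {j : ℕ}
    (h : H j (π j x)) : ∃ i ≤ j, IsStopping π H (i, π i x) := by
  classical
  have hex : ∃ i, H i (π i x) := ⟨j, h⟩
  refine ⟨Nat.find hex, Nat.find_min' hex h, Nat.find_spec hex, fun y hy i hi => ?_⟩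
  rw [eq_of_nested nest hi.le hy]
  exact Nat.find_min hex hi

theorem IsStopping.eq {π : ℕ → X → ι} {H : ℕ → ι → Prop} {r r' : ℕ × ι}
    (h : IsStopping π H r) (h' : IsStopping π H r') {x : X} (hx : π r.1 x = r.2)
    (hx' : π r'.1 x = r'.2) : r = r' := by
  rcases lt_trichotomy r.1 r'.1 with hlt | heq | hlt
  · exact absurd h.1 (hx ▸ h'.2 x hx' _ hlt)
  · exact Prod.ext heq (by rw [← hx, ← hx', heq])
  · exact absurd h'.1 (hx' ▸ h.2 x hx _ hlt)

/-- The sum over the stopping cells of all levels `2 ^ k`. -/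
theorem tsum_stopping_le [MeasurableSpace X] [Countable ι] (ν : Measure X) {π : ℕ → X → ι}
    (hπ : ∀ j m, MeasurableSet (π j ⁻¹' {m})) (hfin : ∀ j m, ν (π j ⁻¹' {m}) ≠ ∞)
    {g : X → ℝ≥0∞} (hg : Measurable g) {p : ℝ} (hp : 1 < p) :
    ∑' k : ℤ, ∑' r : {r // IsStopping π (fun j m => (2 : ℝ≥0∞) ^ k * ν (π j ⁻¹' {m}) <
        ∫⁻ y in π j ⁻¹' {m}, g y ∂ν) r},
      ((2 : ℝ≥0∞) ^ k) ^ p * ν (π r.1.1 ⁻¹' {r.1.2}) ≤ layerConst p * ∫⁻ y, g y ^ p ∂ν := by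
  have hm : ∀ k : ℤ, Measurable fun y => if (2 : ℝ≥0∞) ^ k < 2 * g y then g y else 0 := fun k =>
    Measurable.ite (measurableSet_lt measurable_const (hg.const_mul 2)) hg measurable_const
  rw [← lintegral_const_mul _ (hg.pow_const p)]
  refine le_trans ?_ (lintegral_mono fun y => tsum_layer_le hp (g y))
  rw [lintegral_tsum fun k => ((hm k).const_mul _).aemeasurable]
  refine ENNReal.tsum_le_tsum fun k => ?_
  rw [lintegral_const_mul _ (hm k)]
  have hk : (2 : ℝ≥0∞) ^ k ≠ ∞ := ENNReal.zpow_ne_top two_ne_zero (by simp) k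
  set S := {r // IsStopping π (fun j m => (2 : ℝ≥0∞) ^ k * ν (π j ⁻¹' {m}) <
        ∫⁻ y in π j ⁻¹' {m}, g y ∂ν) r}
  have hterm : ∀ r : S, ((2 : ℝ≥0∞) ^ k) ^ p * ν (π r.1.1 ⁻¹' {r.1.2}) ≤
      2 * ((2 : ℝ≥0∞) ^ k) ^ (p - 1) *
        ∫⁻ y in π r.1.1 ⁻¹' {r.1.2}, (if (2 : ℝ≥0∞) ^ k < 2 * g y then g y else 0) ∂ν := by
    intro r
    have h := mul_measure_le_of_lt_setLIntegral ν hg (hfin r.1.1 r.1.2) hk r.2.1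
    calc _ = ((2 : ℝ≥0∞) ^ k) ^ (p - 1) * (2 ^ k * ν (π r.1.1 ⁻¹' {r.1.2})) := by
          conv_lhs => rw [show p = (p - 1) + 1 by ring,
            ENNReal.rpow_add_of_nonneg _ _ (by linarith) zero_le_one, ENNReal.rpow_one]
          rw [mul_assoc]
      _ ≤ _ := by
          rw [mul_comm 2, mul_assoc]
          gcongr
  refine (ENNReal.tsum_le_tsum hterm).trans ?_
  rw [ENNReal.tsum_mul_left, ← lintegral_iUnion (fun r : S => hπ r.1.1 r.1.2)]
  · gcongr
    exact Measure.restrict_le_self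
  · intro r r' hne
    refine Set.disjoint_left.2 fun x hx hx' => hne (Subtype.ext (r.2.eq r'.2 hx hx'))

theorem measurable_comp_cell [MeasurableSpace X] [Countable ι] {π : ℕ → X → ι}
    (hπ : ∀ j m, MeasurableSet (π j ⁻¹' {m})) (j : ℕ) (F : ι → ℝ≥0∞) :
    Measurable fun x => F (π j x) := by
  let _ : MeasurableSpace ι := ⊤
  exact measurable_from_top.comp (measurable_to_countable' (hπ j))

/-- Sawyer's testing theorem for a nested sequence of countable partitions. -/
theorem lintegral_cellMax_le [MeasurableSpace X] [Countable ι] (μ ν : Measure X) {π : ℕ → X → ι}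
    (hπ : ∀ j m, MeasurableSet (π j ⁻¹' {m}))
    (nest : ∀ j x y, π (j + 1) x = π (j + 1) y → π j x = π j y)
    (hfin : ∀ j m, ν (π j ⁻¹' {m}) ≠ ∞) (c : ℕ → ℝ≥0∞)
    {g : X → ℝ≥0∞} (hg : Measurable g) (hgfin : ∀ j m, ∫⁻ y in π j ⁻¹' {m}, g y ∂ν ≠ ∞)
    {p q : ℝ} (hp : 1 < p) (hpq : p ≤ q) (K : ℝ≥0∞)
    (test : ∀ i m, ν (π i ⁻¹' {m}) ≠ 0 →
      ∫⁻ x in π i ⁻¹' {m}, (⨆ j, ⨆ _ : i ≤ j, c j * ν (π j ⁻¹' {π j x})) ^ q ∂μ ≤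
        K ^ q * ν (π i ⁻¹' {m}) ^ (q / p)) :
    ∫⁻ x, (⨆ j, c j * ∫⁻ y in π j ⁻¹' {π j x}, g y ∂ν) ^ q ∂μ ≤
      (2 * K) ^ q * (layerConst p * ∫⁻ y, g y ^ p ∂ν) ^ (q / p) := by
  have hp0 : 0 < p := by linarith
  have hq0 : 0 < q := by linarith
  set H : ℤ → ℕ → ι → Prop := fun k j m => (2 : ℝ≥0∞) ^ k * ν (π j ⁻¹' {m}) <
        ∫⁻ y in π j ⁻¹' {m}, g y ∂ν with hH
  set T : ℕ → X → ℝ≥0∞ := fun i x => ⨆ j, ⨆ _ : i ≤ j, c j * ν (π j ⁻¹' {π j x}) with hT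
  have hTm : ∀ i, Measurable (T i) := fun i =>
    Measurable.iSup fun j => Measurable.iSup fun _ =>
      measurable_comp_cell hπ j fun m => c j * ν (π j ⁻¹' {m})
  have point : ∀ x, (⨆ j, c j * ∫⁻ y in π j ⁻¹' {π j x}, g y ∂ν) ^ q ≤
      ∑' k : ℤ, ∑' r : {r // IsStopping π (H k) r},
        (π r.1.1 ⁻¹' {r.1.2}).indicator (fun x => ((2 : ℝ≥0∞) ^ (k + 1) * T r.1.1 x) ^ q) x := by
    intro x
    rw [← ENNReal.le_rpow_inv_iff hq0]
    refine iSup_le fun j => ?_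
    rw [ENNReal.le_rpow_inv_iff hq0]
    set I := ∫⁻ y in π j ⁻¹' {π j x}, g y ∂ν with hI
    set v := ν (π j ⁻¹' {π j x}) with hv
    rcases eq_or_ne I 0 with h0 | h0
    · simp [h0, hq0]
    have hv0 : v ≠ 0 := fun h => h0 (by rw [hI, Measure.restrict_eq_zero.2 h]; simp)
    have hvt : v ≠ ∞ := hfin _ _
    -- The average lies in (2^k, 2^(k+1)]: the strict lower bound makes the cell heavy at level k,
    -- and the upper bound costs the factor 2 in 2K.
    obtain ⟨k, hk, hk'⟩ := ENNReal.exists_mem_Ioc_zpow (x := I / v) (y := 2)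
      (ENNReal.div_ne_zero.2 ⟨h0, hvt⟩) (ENNReal.div_ne_top (hgfin _ _) hv0) (by simp) (by simp)
    rw [ENNReal.lt_div_iff_mul_lt (Or.inl hv0) (Or.inl hvt)] at hk
    rw [ENNReal.div_le_iff hv0 hvt] at hk'
    obtain ⟨i, hij, hi⟩ := exists_isStopping (H := H k) nest (x := x) (j := j) hk
    refine le_trans ?_ (ENNReal.le_tsum k)
    refine le_trans ?_ (ENNReal.le_tsum (⟨(i, π i x), hi⟩ : {r // IsStopping π (H k) r}))
    rw [indicator_of_mem (by simp)]
    refine ENNReal.rpow_le_rpow ?_ hq0.le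
    calc c j * I ≤ c j * (2 ^ (k + 1) * v) := by gcongr
      _ = 2 ^ (k + 1) * (c j * v) := by ring
      _ ≤ _ := by
        gcongr
        exact le_iSup₂ (f := fun j (_ : i ≤ j) => c j * ν (π j ⁻¹' {π j x})) j hij
  refine (lintegral_mono point).trans ?_
  rw [lintegral_tsum fun k => (Measurable.tsum fun r =>
    (((hTm _).const_mul _).pow_const q).indicator (hπ _ _)).aemeasurable]
  have hs : 1 ≤ q / p := (one_le_div hp0).2 hpq
  calc _ ≤ ∑' k : ℤ, ∑' r : {r // IsStopping π (H k) r},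
        (2 * K) ^ q * (((2 : ℝ≥0∞) ^ k) ^ p * ν (π r.1.1 ⁻¹' {r.1.2})) ^ (q / p) := by
        refine ENNReal.tsum_le_tsum fun k => ?_
        rw [lintegral_tsum fun r =>
          ((((hTm _).const_mul _).pow_const q).indicator (hπ _ _)).aemeasurable]
        refine ENNReal.tsum_le_tsum fun r => ?_
        rw [lintegral_indicator (hπ _ _)]
        simp_rw [ENNReal.mul_rpow_of_nonneg _ _ hq0.le]
        rw [lintegral_const_mul _ ((hTm _).pow_const q)]
        -- On a null cell heaviness would read 0 < 0.
        have hne : ν (π r.1.1 ⁻¹' {r.1.2}) ≠ 0 := fun h => by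
          have hheavy : (2 : ℝ≥0∞) ^ k * ν (π r.1.1 ⁻¹' {r.1.2}) <
            ∫⁻ y in π r.1.1 ⁻¹' {r.1.2}, g y ∂ν := r.2.1
          simp only [Measure.restrict_eq_zero.2 h, h] at hheavy
          simp at hheavy
        refine (mul_le_mul_right (test _ _ hne) _).trans (le_of_eq ?_)
        rw [ENNReal.mul_rpow_of_nonneg _ _ (by positivity), ← ENNReal.rpow_mul,
          mul_div_cancel₀ _ hp0.ne', ENNReal.zpow_add two_ne_zero (by simp), zpow_one,
          ENNReal.mul_rpow_of_nonneg _ _ hq0.le]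
        ring
    _ ≤ (2 * K) ^ q * (∑' k : ℤ, ∑' r : {r // IsStopping π (H k) r},
        ((2 : ℝ≥0∞) ^ k) ^ p * ν (π r.1.1 ⁻¹' {r.1.2})) ^ (q / p) := by
        simp_rw [ENNReal.tsum_mul_left]
        gcongr
        -- Superadditivity of s ↦ s^(q/p), once over the levels and once over the cells of a level.
        refine le_trans (ENNReal.tsum_le_tsum fun k => ?_) (ENNReal.tsum_rpow_le_rpow_tsum _ hs)
        rw [← ENNReal.tsum_mul_left]
        exact ENNReal.tsum_rpow_le_rpow_tsum _ hs
    _ ≤ _ := by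
        gcongr
        exact tsum_stopping_le ν hπ hfin hg hp

end Stopping

/-! ### Cubes, shifted dyadic grids and pointwise domination -/

section Cubes

variable {n : ℕ}

theorem Cube.measurableSet (Q : Cube n) : MeasurableSet Q.set :=
  MeasurableSet.univ_pi fun _ => measurableSet_Ico

theorem Cube.volume_set (Q : Cube n) : volume Q.set = ENNReal.ofReal (Q.side ^ n) := by
  rw [Cube.set, Real.volume_pi_Ico]
  simp [ENNReal.ofReal_pow Q.side_pos.le]

theorem Cube.mem_set {Q : Cube n} {x : Fin n → ℝ} :
    x ∈ Q.set ↔ ∀ i, Q.corner i ≤ x i ∧ x i < Q.corner i + Q.side := by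
  simp [Cube.set, mem_pi]

theorem fracMax_eq_iSup (hn : n ≠ 0) (α : ℝ) (f : (Fin n → ℝ) → ℝ) (x : Fin n → ℝ) :
    fracMax α f x = ⨆ Q : Cube n, Q.set.indicator
      (fun _ => ENNReal.ofReal (Q.side ^ (α - n)) * ∫⁻ y in Q.set, ‖f y‖ₑ) x := by
  unfold fracMax
  congr 1
  ext Q
  congr 1
  ext y
  have hs := Q.side_pos
  have hn' : (n : ℝ) ≠ 0 := Nat.cast_ne_zero.2 hn
  rw [setLAverage_eq, Q.volume_set, ENNReal.div_eq_inv_mul, ← mul_assoc]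
  congr 1
  rw [ENNReal.ofReal_rpow_of_pos (by positivity), ← ENNReal.ofReal_inv_of_pos (by positivity),
    ← ENNReal.ofReal_mul (by positivity)]
  congr 1
  rw [← Real.rpow_natCast, ← Real.rpow_mul hs.le, mul_div_cancel₀ _ hn', Real.rpow_sub hs,
    div_eq_mul_inv]

theorem le_fracMax (hn : n ≠ 0) (α : ℝ) (f : (Fin n → ℝ) → ℝ) {x : Fin n → ℝ} {Q : Cube n}
    (hx : x ∈ Q.set) :
    ENNReal.ofReal (Q.side ^ (α - n)) * ∫⁻ y in Q.set, ‖f y‖ₑ ≤ fracMax α f x := by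
  rw [fracMax_eq_iSup hn]
  refine le_trans (le_of_eq ?_) (le_iSup _ Q)
  rw [indicator_of_mem hx]

/-- The index of the cell containing `x` in the dyadic grid of mesh `L / 2 ^ j` based at `τ`. -/
noncomputable def gridIndex (τ : Fin n → ℝ) (L : ℝ) (j : ℕ) (x : Fin n → ℝ) : Fin n → ℤ :=
  fun i => ⌊(x i - τ i) / (L / 2 ^ j)⌋

/-- The cell of index `m` in the dyadic grid of mesh `L / 2 ^ j` based at `τ`. -/
noncomputable def gridCube (τ : Fin n → ℝ) {L : ℝ} (hL : 0 < L) (j : ℕ) (m : Fin n → ℤ) :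
    Cube n :=
  ⟨fun i => τ i + m i * (L / 2 ^ j), L / 2 ^ j, by positivity⟩

theorem gridIndex_preimage (τ : Fin n → ℝ) {L : ℝ} (hL : 0 < L) (j : ℕ) (m : Fin n → ℤ) :
    gridIndex τ L j ⁻¹' {m} = (gridCube τ hL j m).set := by
  ext x
  have hd : 0 < L / 2 ^ j := by positivity
  rw [Cube.mem_set, mem_preimage, mem_singleton_iff, funext_iff]
  refine forall_congr' fun i => ?_
  simp only [gridIndex, gridCube, Int.floor_eq_iff, le_div_iff₀ hd, div_lt_iff₀ hd]
  constructor <;> rintro ⟨h1, h2⟩ <;> constructor <;> linarith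

theorem gridIndex_nested (τ : Fin n → ℝ) (L : ℝ) (j : ℕ) (x y : Fin n → ℝ)
    (h : gridIndex τ L (j + 1) x = gridIndex τ L (j + 1) y) :
    gridIndex τ L j x = gridIndex τ L j y := by
  have key : ∀ z i, gridIndex τ L j z i = gridIndex τ L (j + 1) z i / 2 := by
    intro z i
    have : (z i - τ i) / (L / 2 ^ j) = (z i - τ i) / (L / 2 ^ (j + 1)) / (2 : ℕ) := by
      rw [pow_succ]
      push_cast
      rcases eq_or_ne L 0 with rfl | hL
      · simp
      · field_simp
    simp only [gridIndex]
    rw [this, Int.floor_div_natCast]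
    rfl
  ext i
  rw [key, key, h]

/-- If a and y lie in different cells, the left endpoint of the cell of y separates them. -/
theorem floor_eq_or_exists_between {a y s d l : ℝ} (hd : 0 < d) (hy : a ≤ y) (hyl : y < a + l) :
    ⌊(y - s) / d⌋ = ⌊(a - s) / d⌋ ∨ ∃ m : ℤ, a < m * d + s ∧ m * d + s < a + l := by
  refine or_iff_not_imp_left.2 fun hne => ⟨⌊(y - s) / d⌋, ?_, ?_⟩
  · have hle : ⌊(a - s) / d⌋ ≤ ⌊(y - s) / d⌋ := Int.floor_le_floor (by gcongr)
    have hlt := Int.floor_lt.1 (lt_of_le_of_ne hle (Ne.symm hne))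
    rw [div_lt_iff₀ hd] at hlt
    linarith
  · have h := Int.floor_le ((y - s) / d)
    rw [le_div_iff₀ hd] at h
    linarith

/-- The one-third trick: a short interval does not meet both a point of the dyadic lattice of
mesh `L / 2 ^ j` and a point of its translate by `L / 3`. -/
theorem exists_shift_floor_eq {L l a : ℝ} (hL : 0 < L) (j : ℕ) (hl : 3 * l ≤ L / 2 ^ j) :
    ∃ e : Bool, ∀ y, a ≤ y → y < a + l →
      ⌊(y - if e then L / 3 else 0) / (L / 2 ^ j)⌋ =
        ⌊(a - if e then L / 3 else 0) / (L / 2 ^ j)⌋ := by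
  by_contra! hcon
  set d := L / 2 ^ j with hd_def
  have hd : 0 < d := by positivity
  have hLd : L = d * 2 ^ j := by rw [hd_def]; field_simp
  obtain ⟨y, hy, hyl, hne⟩ := hcon false
  obtain ⟨y', hy', hyl', hne'⟩ := hcon true
  obtain ⟨m, hm, hm'⟩ := (floor_eq_or_exists_between hd hy hyl).resolve_left hne
  obtain ⟨k, hk, hk'⟩ := (floor_eq_or_exists_between hd hy' hyl').resolve_left hne'
  -- The points m d and k d + L/3 lie in one interval of length at most d/3. As L = 2^j d, this
  -- gives |3(m - k) - 2^j| < 1, so 3 would divide 2^j.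
  simp only [Bool.false_eq_true, if_false, if_true, hLd] at hm hm' hk hk'
  have h1 : (3 * (m - k) - 2 ^ j : ℝ) < 1 := by
    by_contra! h
    nlinarith
  have h2 : (-1 : ℝ) < 3 * (m - k) - 2 ^ j := by
    by_contra! h
    nlinarith
  have h1' : 3 * (m - k) - 2 ^ j < (1 : ℤ) := by exact_mod_cast h1
  have h2' : (-1 : ℤ) < 3 * (m - k) - 2 ^ j := by exact_mod_cast h2
  have h3 : (3 : ℤ) ∣ 2 ^ j := ⟨m - k, by omega⟩
  have h4 : (3 : ℤ) ∣ 2 := Int.prime_three.dvd_of_dvd_pow h3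
  omega

/-- The translation vectors of the `2 ^ n` dyadic grids. -/
noncomputable def gridShift (L : ℝ) (e : Fin n → Bool) : Fin n → ℝ :=
  fun i => if e i then L / 3 else 0

theorem Cube.exists_subset_grid (Q : Cube n) {L : ℝ} (hQ : 3 * Q.side ≤ L) {x : Fin n → ℝ}
    (hx : x ∈ Q.set) : ∃ (e : Fin n → Bool) (j : ℕ), L / 2 ^ j ≤ 6 * Q.side ∧
      Q.set ⊆ gridIndex (gridShift L e) L j ⁻¹' {gridIndex (gridShift L e) L j x} := by
  have hs := Q.side_pos
  have hL : 0 < L := by linarith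
  -- The mesh L / 2^j lands in [3ℓ, 6ℓ) with ℓ the side of Q: large enough for the one-third trick,
  -- and comparable to ℓ.
  obtain ⟨j, hj, hj'⟩ := exists_nat_pow_near (x := L / (3 * Q.side)) (y := 2)
    ((one_le_div (by positivity)).2 hQ) one_lt_two
  rw [le_div_iff₀ (by positivity)] at hj
  rw [div_lt_iff₀ (by positivity)] at hj'
  have h3 : 3 * Q.side ≤ L / 2 ^ j := by
    rw [le_div_iff₀ (by positivity)]
    linarith
  -- Each coordinate picks its own shift, whence 2^n grids.
  choose e he using fun i => exists_shift_floor_eq (a := Q.corner i) hL j h3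
  refine ⟨e, j, ?_, fun y hy => ?_⟩
  · rw [div_le_iff₀ (by positivity)]
    rw [pow_succ] at hj'
    linarith
  · ext i
    rw [Cube.mem_set] at hx hy
    exact (he i (y i) (hy i).1 (hy i).2).trans (he i (x i) (hx i).1 (hx i).2).symm

/-- The dyadic fractional maximal operator of the grid of mesh `L / 2 ^ j`, `j ≥ 0`. -/
noncomputable def gridMax (α : ℝ) (τ : Fin n → ℝ) (L : ℝ) (f : (Fin n → ℝ) → ℝ)
    (x : Fin n → ℝ) : ℝ≥0∞ :=
  ⨆ j : ℕ, ENNReal.ofReal ((L / 2 ^ j) ^ (α - n)) *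
    ∫⁻ y in gridIndex τ L j ⁻¹' {gridIndex τ L j x}, ‖f y‖ₑ

theorem measurableSet_gridIndex (τ : Fin n → ℝ) {L : ℝ} (hL : 0 < L) (j : ℕ) (m : Fin n → ℤ) :
    MeasurableSet (gridIndex τ L j ⁻¹' {m}) :=
  gridIndex_preimage τ hL j m ▸ Cube.measurableSet _

theorem measurable_gridMax (α : ℝ) (τ : Fin n → ℝ) {L : ℝ} (hL : 0 < L) (f : (Fin n → ℝ) → ℝ) :
    Measurable (gridMax α τ L f) :=
  Measurable.iSup fun j => measurable_comp_cell (measurableSet_gridIndex τ hL) j fun m =>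
    ENNReal.ofReal ((L / 2 ^ j) ^ (α - n)) * ∫⁻ y in gridIndex τ L j ⁻¹' {m}, ‖f y‖ₑ

theorem rpow_side_le {α l d : ℝ} (hα₀ : 0 ≤ α) (hαn : α < n) (hl : 0 < l) (hd : 0 < d)
    (h : d ≤ 6 * l) : l ^ (α - n) ≤ 6 ^ n * d ^ (α - n) := by
  calc l ^ (α - n) ≤ 6 ^ α * l ^ (α - n) :=
        le_mul_of_one_le_left (by positivity) (Real.one_le_rpow (by norm_num) hα₀)
    _ = 6 ^ n * (6 * l) ^ (α - n) := by
        rw [Real.mul_rpow (by norm_num) hl.le, ← mul_assoc, ← Real.rpow_natCast 6 n,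
          ← Real.rpow_add (by norm_num)]
        congr 2
        ring
    _ ≤ 6 ^ n * d ^ (α - n) := by
        gcongr 6 ^ n * ?_
        exact Real.rpow_le_rpow_of_nonpos hd h (by linarith)

theorem Cube.term_le_gridMax {α : ℝ} (hα₀ : 0 ≤ α) (hαn : α < n) (f : (Fin n → ℝ) → ℝ)
    (Q : Cube n) {L : ℝ} (hQ : 3 * Q.side ≤ L) {x : Fin n → ℝ} (hx : x ∈ Q.set) :
    ∃ e : Fin n → Bool, ENNReal.ofReal (Q.side ^ (α - n)) * ∫⁻ y in Q.set, ‖f y‖ₑ ≤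
      6 ^ n * gridMax α (gridShift L e) L f x := by
  obtain ⟨e, j, hj, hsub⟩ := Q.exists_subset_grid hQ hx
  have hs := Q.side_pos
  have hd : 0 < L / 2 ^ j := div_pos (by linarith) (by positivity)
  refine ⟨e, ?_⟩
  calc _ ≤ ENNReal.ofReal (6 ^ n * (L / 2 ^ j) ^ (α - n)) *
        ∫⁻ y in gridIndex (gridShift L e) L j ⁻¹' {gridIndex (gridShift L e) L j x}, ‖f y‖ₑ := by
        gcongr
        exact rpow_side_le hα₀ hαn hs hd hj
    _ ≤ _ := by
        rw [ENNReal.ofReal_mul (by positivity), mul_assoc, ENNReal.ofReal_pow (by norm_num),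
          ENNReal.ofReal_ofNat]
        gcongr
        exact le_iSup (fun j : ℕ => ENNReal.ofReal ((L / 2 ^ j) ^ (α - n)) *
          ∫⁻ y in gridIndex (gridShift L e) L j ⁻¹' {gridIndex (gridShift L e) L j x}, ‖f y‖ₑ) j

/-- A given cube is covered once 2^N exceeds three times its side, so domination holds only
eventually in N. The grids move with N, so there is no monotonicity; the good shift may also vary,
hence the sum over e. -/
theorem fracMax_rpow_le_liminf {α q : ℝ} (hα₀ : 0 ≤ α) (hαn : α < n) (hq : 0 < q)
    (f : (Fin n → ℝ) → ℝ) (x : Fin n → ℝ) :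
    fracMax α f x ^ q ≤ Filter.liminf (fun N : ℕ => ∑ e : Fin n → Bool,
      (6 ^ n * gridMax α (gridShift (2 ^ N) e) (2 ^ N) f x) ^ q) Filter.atTop := by
  have hn : n ≠ 0 := by
    rintro rfl
    simp at hαn
    linarith
  rw [← ENNReal.le_rpow_inv_iff hq, fracMax_eq_iSup hn]
  refine iSup_le fun Q => indicator_apply_le' (fun hx => ?_) fun _ => zero_le
  rw [ENNReal.le_rpow_inv_iff hq]
  obtain ⟨N₀, hN₀⟩ := pow_unbounded_of_one_lt (3 * Q.side) one_lt_two
  refine Filter.le_liminf_of_le (by isBoundedDefault) ?_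
  filter_upwards [Filter.eventually_ge_atTop N₀] with N hN
  obtain ⟨e, he⟩ := Q.term_le_gridMax hα₀ hαn f (L := 2 ^ N)
    (hN₀.le.trans (pow_le_pow_right₀ one_le_two hN)) hx
  refine (ENNReal.rpow_le_rpow he hq.le).trans ?_
  exact Finset.single_le_sum (f := fun e : Fin n → Bool =>
    (6 ^ n * gridMax α (gridShift (2 ^ N) e) (2 ^ N) f x) ^ q) (fun _ _ => zero_le)
    (Finset.mem_univ e)

end Cubes

/-! ### From testing to the strong type bound -/

section Weights

variable {n : ℕ}

theorem IsWeight.setLIntegral_weightMeasure {σ : (Fin n → ℝ) → ℝ} (hσ : IsWeight σ)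
    (f : (Fin n → ℝ) → ℝ) (hf : AEMeasurable f (weightMeasure σ)) (s : Set (Fin n → ℝ))
    (hs : MeasurableSet s) :
    ∫⁻ y in s, ‖f y‖ₑ ∂(weightMeasure σ) = ∫⁻ y in s, ‖f y * σ y‖ₑ := by
  have hr : (weightMeasure σ).restrict s =
      (volume.restrict s).withDensity fun x => ENNReal.ofReal (σ x) :=
    restrict_withDensity hs _
  have hf' : AEMeasurable (fun y => ‖f y‖ₑ) ((weightMeasure σ).restrict s) := hf.enorm.restrict
  rw [hr] at hf' ⊢
  rw [lintegral_withDensity_eq_lintegral_mul₀' hσ.aemeasurable.ennreal_ofReal.restrict hf']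
  refine lintegral_congr fun y => ?_
  rw [Pi.mul_apply, enorm_mul, Real.enorm_of_nonneg (hσ.nonneg y), mul_comm]

theorem IsWeight.setLIntegral_enorm {σ : (Fin n → ℝ) → ℝ} (hσ : IsWeight σ)
    (s : Set (Fin n → ℝ)) : ∫⁻ y in s, ‖σ y‖ₑ = weightMeasure σ s := by
  rw [weightMeasure, withDensity_apply']
  exact lintegral_congr fun y => Real.enorm_of_nonneg (hσ.nonneg y)

theorem IsWeight.setLIntegral_indicator {σ : (Fin n → ℝ) → ℝ} (hσ : IsWeight σ)
    {s t : Set (Fin n → ℝ)} (hs : MeasurableSet s) (hst : s ⊆ t) :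
    ∫⁻ y in t, ‖s.indicator σ y‖ₑ = weightMeasure σ s := by
  simp_rw [enorm_indicator_eq_indicator_enorm]
  rw [_root_.MeasureTheory.setLIntegral_indicator hs, inter_eq_left.2 hst, hσ.setLIntegral_enorm]

theorem setLIntegral_fracMax_le {α p q : ℝ} (hq : 0 < q)
    (u σ : (Fin n → ℝ) → ℝ) (Q : Cube n) (h0 : weightMeasure σ Q.set ≠ 0)
    (hfin : weightMeasure σ Q.set ≠ ∞) :
    ∫⁻ x in Q.set, fracMax α (Q.set.indicator σ) x ^ q ∂(weightMeasure u) ≤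
      testingConst α p q u σ ^ q * weightMeasure σ Q.set ^ (q / p) := by
  set v := weightMeasure σ Q.set
  set I := ∫⁻ x in Q.set, fracMax α (Q.set.indicator σ) x ^ q ∂(weightMeasure u)
  have h : v ^ (-1 / p) * I ^ (1 / q) ≤ testingConst α p q u σ :=
    le_iSup (fun Q : Cube n => weightMeasure σ Q.set ^ (-1 / p) *
      (∫⁻ x in Q.set, fracMax α (Q.set.indicator σ) x ^ q ∂(weightMeasure u)) ^ (1 / q)) Q
  have h1 : I ^ (1 / q) ≤ testingConst α p q u σ * v ^ (1 / p) := by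
    calc I ^ (1 / q) = v ^ (-1 / p) * I ^ (1 / q) * v ^ (1 / p) := by
          rw [mul_right_comm, ← ENNReal.rpow_add _ _ h0 hfin, ← add_div]
          simp
      _ ≤ _ := by gcongr
  calc I = (I ^ (1 / q)) ^ q := by rw [← ENNReal.rpow_mul, one_div_mul_cancel hq.ne',
        ENNReal.rpow_one]
    _ ≤ (testingConst α p q u σ * v ^ (1 / p)) ^ q := by gcongr
    _ = _ := by
      rw [ENNReal.mul_rpow_of_nonneg _ _ hq.le, ← ENNReal.rpow_mul]
      congr 2
      ring

theorem lintegral_gridMax_le (hn : n ≠ 0) {α p q : ℝ} (hp : 1 < p) (hpq : p ≤ q)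
    {u σ : (Fin n → ℝ) → ℝ} (hσ : IsWeight σ)
    (hfin : ∀ Q : Cube n, weightMeasure σ Q.set < ∞) (τ : Fin n → ℝ) {L : ℝ} (hL : 0 < L)
    {f : (Fin n → ℝ) → ℝ} (hf : MemLp f (ENNReal.ofReal p) (weightMeasure σ)) :
    ∫⁻ x, gridMax α τ L (fun y => f y * σ y) x ^ q ∂(weightMeasure u) ≤
      (2 * testingConst α p q u σ) ^ q *
        (layerConst p * ∫⁻ x, ‖f x‖ₑ ^ p ∂(weightMeasure σ)) ^ (q / p) := by
  have hq0 : 0 < q := by linarith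
  have hfm : AEMeasurable f (weightMeasure σ) := hf.1.aemeasurable
  -- The abstract theorem needs a measurable function, while |f| is only a.e. measurable for σ dx.
  set g : (Fin n → ℝ) → ℝ≥0∞ := hfm.enorm.mk _ with hg
  have hgm : Measurable g := hfm.enorm.measurable_mk
  have hfg : (fun x => ‖f x‖ₑ) =ᵐ[weightMeasure σ] g := hfm.enorm.ae_eq_mk
  have hcell := measurableSet_gridIndex τ hL
  have hcfin : ∀ j m, weightMeasure σ (gridIndex τ L j ⁻¹' {m}) ≠ ∞ := fun j m => by
    rw [gridIndex_preimage τ hL]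
    exact (hfin _).ne
  have hint : ∀ s, ∫⁻ y in s, g y ∂(weightMeasure σ) =
      ∫⁻ y in s, ‖f y‖ₑ ∂(weightMeasure σ) := fun s =>
    lintegral_congr_ae (ae_restrict_of_ae hfg.symm)
  have hpow : ∫⁻ x, ‖f x‖ₑ ^ p ∂(weightMeasure σ) = ∫⁻ x, g x ^ p ∂(weightMeasure σ) :=
    lintegral_congr_ae (hfg.mono fun x hx => congrArg (· ^ p) hx)
  rw [hpow]
  refine le_trans (lintegral_mono fun x => ?_) (lintegral_cellMax_le (weightMeasure u)
    (weightMeasure σ) hcell (gridIndex_nested τ L) hcfin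
    (fun j => ENNReal.ofReal ((L / 2 ^ j) ^ (α - n))) hgm ?_ hp hpq _ ?_)
  · refine ENNReal.rpow_le_rpow (iSup_mono fun j => ?_) (by linarith)
    rw [hint, hσ.setLIntegral_weightMeasure f hfm _ (hcell _ _)]
  · intro j m
    rw [hint]
    have : IsFiniteMeasure ((weightMeasure σ).restrict (gridIndex τ L j ⁻¹' {m})) :=
      ⟨by rw [Measure.restrict_apply_univ]; exact (hcfin j m).lt_top⟩
    have h1 : MemLp f 1 ((weightMeasure σ).restrict (gridIndex τ L j ⁻¹' {m})) :=
      (hf.restrict _).mono_exponent (by simpa using ENNReal.ofReal_le_ofReal hp.le)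
    have h2 := h1.2
    rw [eLpNorm_one_eq_lintegral_enorm] at h2
    exact h2.ne
  · intro i m hne
    have hfi := hcfin i m
    rw [gridIndex_preimage τ hL] at hne hfi
    refine le_trans ?_ ((setLIntegral_fracMax_le (α := α) (p := p) hq0 u σ
      (gridCube τ hL i m) hne hfi).trans (le_of_eq (by rw [gridIndex_preimage τ hL])))
    rw [gridIndex_preimage τ hL]
    refine setLIntegral_mono' (Cube.measurableSet _) fun x hx => ?_
    -- A cell around x of level j ≥ i lies inside the tested cell, so its term competes in the
    -- supremum defining the maximal function of σ restricted to that cell.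
    refine ENNReal.rpow_le_rpow (iSup₂_le fun j hij => ?_) (by linarith)
    have hxm : gridIndex τ L i x = m := by
      rw [← gridIndex_preimage τ hL] at hx
      exact hx
    have hsub : (gridCube τ hL j (gridIndex τ L j x)).set ⊆ (gridCube τ hL i m).set := by
      rw [← gridIndex_preimage, ← gridIndex_preimage]
      intro y hy
      exact (eq_of_nested (gridIndex_nested τ L) hij hy).trans hxm
    have hmem : x ∈ (gridCube τ hL j (gridIndex τ L j x)).set := by
      rw [← gridIndex_preimage]
      rfl
    refine le_trans (le_of_eq ?_) (le_fracMax hn α ((gridCube τ hL i m).set.indicator σ) hmem)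
    simp_rw [enorm_indicator_eq_indicator_enorm]
    rw [setLIntegral_indicator (Cube.measurableSet _), inter_eq_right.2 hsub,
      hσ.setLIntegral_enorm, gridIndex_preimage τ hL]
    rfl

theorem strongTypeBound_of_testing {α p q : ℝ} (hα₀ : 0 ≤ α) (hαn : α < n) (hp : 1 < p)
    (hpq : p ≤ q) {u σ : (Fin n → ℝ) → ℝ} (hσ : IsWeight σ)
    (hfin : ∀ Q : Cube n, weightMeasure σ Q.set < ∞) :
    StrongTypeBound α p q u σ
      (2 ^ n * (6 ^ n * 2) * layerConst p ^ (1 / p) * testingConst α p q u σ) := by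
  intro f hf
  have hn : n ≠ 0 := by
    rintro rfl
    simp at hαn
    linarith
  have hp0 : 0 < p := by linarith
  have hq1 : 1 < q := by linarith
  have hq0 : 0 < q := by linarith
  set K := testingConst α p q u σ
  set F := ∫⁻ x, ‖f x‖ₑ ^ p ∂(weightMeasure σ)
  have hm : ∀ (N : ℕ) (e : Fin n → Bool), Measurable fun x =>
      (6 ^ n * gridMax α (gridShift (2 ^ N) e) (2 ^ N) (fun y => f y * σ y) x) ^ q := fun N e =>
    ((measurable_gridMax α _ (by positivity) _).const_mul _).pow_const q
  have key : ∫⁻ x, fracMax α (fun y => f y * σ y) x ^ q ∂(weightMeasure u) ≤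
      2 ^ n * ((6 ^ n) ^ q * ((2 * K) ^ q * (layerConst p * F) ^ (q / p))) := by
    refine (lintegral_mono fun x => fracMax_rpow_le_liminf hα₀ hαn hq0 _ x).trans ?_
    refine (lintegral_liminf_le fun N => Finset.measurable_fun_sum _ fun e _ => hm N e).trans ?_
    -- The bound is uniform in N, so any single N past the threshold suffices.
    refine Filter.liminf_le_of_le (by isBoundedDefault) fun b hb => ?_
    obtain ⟨N, hN⟩ := hb.exists
    refine hN.trans ?_
    rw [lintegral_finsetSum _ fun e _ => hm N e]
    refine (Finset.sum_le_card_nsmul _ _ ((6 ^ n) ^ q * ((2 * K) ^ q *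
      (layerConst p * F) ^ (q / p))) fun e _ => ?_).trans (le_of_eq ?_)
    · simp_rw [ENNReal.mul_rpow_of_nonneg _ _ hq0.le]
      rw [lintegral_const_mul _ ((measurable_gridMax α _ (by positivity) _).pow_const q)]
      gcongr
      rw [← ENNReal.mul_rpow_of_nonneg _ _ hq0.le]
      exact lintegral_gridMax_le hn hp hpq hσ hfin _ (by positivity) hf
    · simp
  have hinv : 0 ≤ 1 / q := by positivity
  have hroot : ∀ x : ℝ≥0∞, (x ^ q) ^ (1 / q) = x := fun x => by
    rw [← ENNReal.rpow_mul, mul_one_div_cancel hq0.ne', ENNReal.rpow_one]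
  calc _ ≤ (2 ^ n * ((6 ^ n) ^ q * ((2 * K) ^ q * (layerConst p * F) ^ (q / p)))) ^ (1 / q) :=
        ENNReal.rpow_le_rpow key hinv
    _ = ((2 : ℝ≥0∞) ^ n) ^ (1 / q) * (6 ^ n * (2 * K * (layerConst p * F) ^ (1 / p))) := by
        rw [ENNReal.mul_rpow_of_nonneg _ _ hinv, ENNReal.mul_rpow_of_nonneg _ _ hinv,
          ENNReal.mul_rpow_of_nonneg _ _ hinv, hroot, hroot, ← ENNReal.rpow_mul]
        congr 4
        field_simp
    _ ≤ 2 ^ n * (6 ^ n * (2 * K * (layerConst p * F) ^ (1 / p))) := by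
        gcongr
        -- Replacing the exponent 1/q by 1 keeps the constant independent of q.
        conv_rhs => rw [← ENNReal.rpow_one ((2 : ℝ≥0∞) ^ n)]
        exact ENNReal.rpow_le_rpow_of_exponent_le (one_le_pow_of_one_le' (by simp) n)
          ((div_le_one hq0).2 hq1.le)
    _ = _ := by
        rw [ENNReal.mul_rpow_of_nonneg _ _ (by positivity)]
        ring

/-! ### Necessity of the testing condition -/

theorem StrongTypeBound.indicator {α p q : ℝ} (hp : 0 < p) {u σ : (Fin n → ℝ) → ℝ} {A : ℝ≥0∞}
    (h : StrongTypeBound α p q u σ A) {s : Set (Fin n → ℝ)} (hs : MeasurableSet s)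
    (hfin : weightMeasure σ s ≠ ∞) :
    (∫⁻ x, fracMax α (s.indicator σ) x ^ q ∂(weightMeasure u)) ^ (1 / q) ≤
      A * weightMeasure σ s ^ (1 / p) := by
  have h1 := h (s.indicator fun _ => 1) (memLp_indicator_const _ hs 1 (Or.inr hfin))
  have h2 : (fun y => s.indicator (fun _ => (1 : ℝ)) y * σ y) = s.indicator σ := by
    ext y
    by_cases hy : y ∈ s <;> simp [hy]
  have h3 : ∫⁻ x, ‖s.indicator (fun _ => (1 : ℝ)) x‖ₑ ^ p ∂(weightMeasure σ) =
      weightMeasure σ s := by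
    rw [← lintegral_indicator_one hs]
    refine lintegral_congr fun x => ?_
    by_cases hx : x ∈ s <;> simp [hx, hp]
  rwa [h2, h3] at h1

theorem StrongTypeBound.testingConst_le {α p q : ℝ} (hp : 0 < p) (hq : 0 < q)
    {u σ : (Fin n → ℝ) → ℝ} {A : ℝ≥0∞} (h : StrongTypeBound α p q u σ A)
    (hfin : ∀ Q : Cube n, weightMeasure σ Q.set < ∞) : testingConst α p q u σ ≤ A := by
  refine iSup_le fun Q => ?_
  have h1 : (∫⁻ x in Q.set, fracMax α (Q.set.indicator σ) x ^ q ∂(weightMeasure u)) ^ (1 / q) ≤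
      A * weightMeasure σ Q.set ^ (1 / p) :=
    (ENNReal.rpow_le_rpow (setLIntegral_le_lintegral _ _) (by positivity)).trans
      (h.indicator hp Q.measurableSet (hfin Q).ne)
  rcases eq_or_ne (weightMeasure σ Q.set) 0 with h0 | h0
  -- Here the prefactor 0^(-1/p) is ∞; the product is 0 because the integral vanishes.
  · rw [h0, ENNReal.zero_rpow_of_pos (by positivity), mul_zero, nonpos_iff_eq_zero] at h1
    rw [h1, mul_zero]
    exact zero_le
  · calc _ ≤ weightMeasure σ Q.set ^ (-1 / p) * (A * weightMeasure σ Q.set ^ (1 / p)) := by gcongr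
      _ = A := by
        rw [mul_left_comm, ← ENNReal.rpow_add _ _ h0 (hfin Q).ne, ← add_div]
        simp

/-- u may vanish on Q itself, but concentric enlargements of Q exhaust the space. -/
theorem IsWeight.exists_cube_ne_zero {u : (Fin n → ℝ) → ℝ} (hu : IsWeight u) (Q : Cube n) :
    ∃ P : Cube n, Q.set ⊆ P.set ∧ weightMeasure u P.set ≠ 0 := by
  have hs := Q.side_pos
  let P : ℕ → Cube n := fun N =>
    ⟨fun i => Q.corner i - N, Q.side + 2 * N, by positivity⟩
  by_contra! hcon
  have hP : ∀ N, weightMeasure u (P N).set = 0 := fun N => hcon _ fun x hx => by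
    rw [Cube.mem_set] at hx ⊢
    intro i
    have hN : (0 : ℝ) ≤ N := N.cast_nonneg
    simp only [P]
    constructor <;> linarith [(hx i).1, (hx i).2]
  have hU : ⋃ N, (P N).set = univ := by
    refine eq_univ_of_forall fun x => ?_
    obtain ⟨N, hN⟩ := exists_nat_gt (∑ i, |x i - Q.corner i|)
    refine mem_iUnion.2 ⟨N, Cube.mem_set.2 fun i => ?_⟩
    have hi : |x i - Q.corner i| ≤ ∑ i, |x i - Q.corner i| :=
      Finset.single_le_sum (f := fun i => |x i - Q.corner i|) (fun _ _ => abs_nonneg _)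
        (Finset.mem_univ i)
    have hlt := abs_lt.1 (hi.trans_lt hN)
    simp only [P]
    constructor <;> linarith [hlt.1, hlt.2]
  have h0 : weightMeasure u univ = 0 := hU ▸ measure_iUnion_null hP
  rw [weightMeasure, withDensity_apply', Measure.restrict_univ,
    lintegral_eq_zero_iff' hu.aemeasurable.ennreal_ofReal] at h0
  refine hu.pos.ne' (measure_mono_null (fun x hx => ?_) (ae_iff.1 h0))
  simpa using hx

/-- Dividing by t^(1/p), legitimate because t is finite, leaves a positive power of t; the resulting
bound does not involve t. -/
theorem ENNReal.le_rpow_of_mul_le_mul_rpow {a A t : ℝ≥0∞} {p : ℝ} (hp : 1 < p) (ha : a ≠ 0)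
    (hA : A ≠ ∞) (ht : t ≠ ∞) (h : a * t ≤ A * t ^ (1 / p)) :
    t ≤ (A / a) ^ (1 - 1 / p)⁻¹ := by
  have hp' : 0 < 1 - 1 / p := sub_pos.2 ((div_lt_one (by linarith)).2 hp)
  rcases eq_or_ne t 0 with rfl | h0
  · exact zero_le
  rw [ENNReal.le_rpow_inv_iff hp', ENNReal.le_div_iff_mul_le (Or.inl ha) (Or.inr hA)]
  have ht' : t ^ (1 / p) ≠ ∞ := ENNReal.rpow_ne_top_of_nonneg (by positivity) ht
  have ht0 : t ^ (1 / p) ≠ 0 := by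
    rw [Ne, ENNReal.rpow_eq_zero_iff]
    simp [h0, ht]
  refine (ENNReal.mul_le_mul_iff_left ht0 ht').1 (le_trans (le_of_eq ?_) h)
  rw [mul_right_comm, ← ENNReal.rpow_add _ _ h0 ht]
  simp [mul_comm]

theorem StrongTypeBound.weightMeasure_lt_top (hn : n ≠ 0) {α p q : ℝ} (hp : 1 < p) (hq : 0 < q)
    {u σ : (Fin n → ℝ) → ℝ} (hu : IsWeight u) (hσ : IsWeight σ) {A : ℝ≥0}
    (h : StrongTypeBound α p q u σ A) (Q : Cube n) : weightMeasure σ Q.set < ∞ := by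
  obtain ⟨P, hQP, hP⟩ := hu.exists_cube_ne_zero Q
  have hPs := P.side_pos
  set ρ := hσ.aemeasurable.mk σ
  have hρ : Measurable ρ := hσ.aemeasurable.measurable_mk
  have hσρ : σ =ᵐ[volume] ρ := hσ.aemeasurable.ae_eq_mk
  -- Truncating σ makes the mass finite, so that χ_{S k} is an admissible test function.
  let S : ℕ → Set (Fin n → ℝ) := fun k => Q.set ∩ {x | ρ x ≤ k}
  have hSm : ∀ k, MeasurableSet (S k) := fun k =>
    Q.measurableSet.inter (measurableSet_le hρ measurable_const)
  have hS : ∀ k, weightMeasure σ (S k) ≠ ∞ := fun k => by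
    have hle : weightMeasure σ (S k) ≤ k * volume Q.set := by
      rw [weightMeasure, withDensity_apply']
      calc ∫⁻ x in S k, ENNReal.ofReal (σ x) = ∫⁻ x in S k, ENNReal.ofReal (ρ x) :=
            lintegral_congr_ae (ae_restrict_of_ae (hσρ.mono fun x hx => by simp only [hx]))
        _ ≤ ∫⁻ _ in S k, k := setLIntegral_mono' (hSm k) fun x hx => by
            simpa using ENNReal.ofReal_le_ofReal hx.2
        _ = k * volume (S k) := setLIntegral_const _ _
        _ ≤ _ := by
            gcongr
            exact inter_subset_left
    refine (hle.trans_lt (ENNReal.mul_lt_top (by simp) ?_)).ne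
    rw [Q.volume_set]
    exact ENNReal.ofReal_lt_top
  set c := ENNReal.ofReal (P.side ^ (α - n)) with hc
  set m := weightMeasure u P.set ^ (1 / q) with hm
  have hcm : c * m ≠ 0 := by
    refine mul_ne_zero ?_ ?_
    · rw [hc, Ne, ENNReal.ofReal_eq_zero, not_le]
      positivity
    · rw [hm, Ne, ENNReal.rpow_eq_zero_iff]
      have : ¬ (1 / q < 0) := not_lt.2 (by positivity)
      simp only [hP, this]
      simp
  -- On P the maximal function of χ_{S k} σ is at least c σ(S k), as P itself is an admissible cube;
  -- the bound is uniform in k and passes to the union.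
  have bound : ∀ k, weightMeasure σ (S k) ≤ (A / (c * m)) ^ (1 - 1 / p)⁻¹ := fun k => by
    refine ENNReal.le_rpow_of_mul_le_mul_rpow hp hcm ENNReal.coe_ne_top (hS k) ?_
    refine le_trans ?_ (h.indicator (by linarith) (hSm k) (hS k))
    calc c * m * weightMeasure σ (S k)
        = (∫⁻ _ in P.set, (c * weightMeasure σ (S k)) ^ q ∂(weightMeasure u)) ^ (1 / q) := by
          rw [setLIntegral_const, ENNReal.mul_rpow_of_nonneg _ _ (by positivity),
            ← ENNReal.rpow_mul, mul_one_div_cancel hq.ne', ENNReal.rpow_one]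
          ring
      _ ≤ (∫⁻ x in P.set, fracMax α ((S k).indicator σ) x ^ q ∂(weightMeasure u)) ^ (1 / q) := by
          refine ENNReal.rpow_le_rpow (setLIntegral_mono' P.measurableSet fun x hx => ?_)
            (by positivity)
          refine ENNReal.rpow_le_rpow ?_ hq.le
          rw [← hσ.setLIntegral_indicator (hSm k) (inter_subset_left.trans hQP)]
          exact le_fracMax hn α _ hx
      _ ≤ _ := ENNReal.rpow_le_rpow (setLIntegral_le_lintegral _ _) (by positivity)
  have hU : ⋃ k, S k = Q.set := by
    rw [← inter_iUnion, inter_eq_left]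
    exact fun x _ => mem_iUnion.2 (exists_nat_ge (ρ x))
  have hmono : Monotone S := fun a b hab =>
    inter_subset_inter_right _ fun x hx => le_trans (α := ℝ) hx (Nat.cast_le.2 hab)
  rw [← hU, hmono.measure_iUnion]
  refine (iSup_le bound).trans_lt ?_
  refine ENNReal.rpow_lt_top_of_nonneg ?_ (ENNReal.div_ne_top ENNReal.coe_ne_top hcm)
  exact inv_nonneg.2 (sub_nonneg.2 ((div_le_one (by linarith)).2 hp.le))

end Weights

theorem mainTheorem2 (n : ℕ) (α p : ℝ) (hα₀ : 0 ≤ α) (hαn : α < (n : ℝ)) (hp : 1 < p) :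
    ∃ C : ℝ≥0, ∀ q : ℝ, p ≤ q → ∀ u σ : (Fin n → ℝ) → ℝ, IsWeight u → IsWeight σ →
      (TestingCondition α p q u σ ↔ ∃ A : ℝ≥0, StrongTypeBound α p q u σ A) ∧
      (TestingCondition α p q u σ →
        StrongTypeBound α p q u σ (C * testingConst α p q u σ)) := by
  have hn : n ≠ 0 := by
    rintro rfl
    simp at hαn
    linarith
  have hp0 : 0 < p := by linarith
  have hC : (2 ^ n * (6 ^ n * 2) * layerConst p ^ (1 / p) : ℝ≥0∞) ≠ ∞ := by
    refine ENNReal.mul_ne_top ?_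
      (ENNReal.rpow_ne_top_of_nonneg (by positivity) (layerConst_ne_top hp))
    finiteness
  refine ⟨(2 ^ n * (6 ^ n * 2) * layerConst p ^ (1 / p) : ℝ≥0∞).toNNReal, ?_⟩
  rw [ENNReal.coe_toNNReal hC]
  intro q hpq u σ hu hσ
  have main : TestingCondition α p q u σ → StrongTypeBound α p q u σ
      (2 ^ n * (6 ^ n * 2) * layerConst p ^ (1 / p) * testingConst α p q u σ) := fun h =>
    strongTypeBound_of_testing hα₀ hαn hp hpq hσ h.1
  refine ⟨⟨fun h => ?_, ?_⟩, main⟩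
  · refine ⟨(2 ^ n * (6 ^ n * 2) * layerConst p ^ (1 / p) * testingConst α p q u σ).toNNReal, ?_⟩
    rw [ENNReal.coe_toNNReal (ENNReal.mul_ne_top hC h.2.ne)]
    exact main h
  · rintro ⟨A, hA⟩
    have hfin := hA.weightMeasure_lt_top hn hp (by linarith) hu hσ
    exact ⟨hfin, (hA.testingConst_le hp0 (by linarith) hfin).trans_lt ENNReal.coe_lt_top⟩
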